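/- Let $\Bbbk$ be an algebraically closed field, $A$ a $\Bbbk$-algebra, and $\mathrm{mod}\,A$ the category of finite-dimensional left $A$-modules. A module $M$ is a *brick* if $\mathrm{End}_A(M)=\Bbbk$ (every endomorphism is multiplication by a unique scalar). Let $r\ge 1$ and let $E_1,\dots,E_r\in\mathrm{mod}\,A$ (indices read modulo $r$) be such that * each $E_i$ is a brick and $\mathrm{Hom}_A(E_i,E_j)=0$ for $i\ne j$ in $\mathbb Z/r$; * they form a $\tau$-cycle: $\tau E_i\cong E_{i-1}$ for all $i\in\mathbb Z/r$, where $\tau$ is the Auslander–Reiten translation of $\mathrm{mod}\,A$, i.e. there is an almost split sequence $0\to E_{i-1}\to F_i\to E_i\to 0$ in $\mathrm{mod}\,A$; * they form a self-hereditary family: $\mathrm{Ext}^2_A(E_i,E_j)=0$ for all $i,j$. Let $\mathcal E$ be the extension category of $E_1,\dots,E_r$: the full subcategory of all modules $M$ having a finite chain of submodules $M=M_0\supsetneq M_1\supsetneq\cdots\supsetneq M_l=0$ ($l\geq 0$) whose factors $M_m/M_{m+1}$ are each isomorphic to one of the $E_i$; the number $l$ is the $\mathcal E$-length of $M$. The indecomposable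 objects of $\mathcal E$ form the standard stable tube $\mathfrak T$ of rank $r$ with mouth $E_1,\dots,E_r$, regarded as a full subcategory of $\mathrm{mod}\,A$, so that $\mathrm{Hom}_{\mathfrak T}=\mathrm{Hom}_A$. Denote by $E_i[j]$ the object of $\mathcal E$ that is uniserial in $\mathcal E$ (its submodules lying in $\mathcal E$ form a chain), has $\mathcal E$-length $j$, and contains a submodule isomorphic to $E_i$. **Theorem 2.7.** For all $1\le i,j\le r$ the object $E_i[j]$ exists and is unique up to isomorphism, and for all $1\le i,j,i',j'\le r$ the following hold. 1. $E_i[j]$ is a brick: $\mathrm{End}_{\mathfrak T}(E_i[j])\cong\Bbbk$. 2. $\mathrm{Hom}_{\mathfrak T}(E_i[j],E_{i'}[j'])\ne 0$ if and only if one of the following conditions is satisfied: * (2a) $i\le i'\le i+j-1$ and $i+j\le i'+j'$; * (2b) $i'\le i+j-1-r$ and $i+j\le i'+j'+r$ (so (2b) never holds if $i+j-1-r<1$). Moreover, if $\mathrm{Hom}_{\mathfrak T}(E_i[j],E_{i'}[j'])\neq 0$, then $\mathrm{Hom}_{\mathfrak T}(E_i[j],E_{i'}[j'])\cong\Bbbk$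 as a $\Bbbk$-vector space. -/

import Mathlib

open CategoryTheory
open scoped ModuleCat

universe w u

namespace StableTube

section

variable (k : Type w) [Field k] {A : Type u} [Ring A] [Algebra k A]

/-- A left `A`-module is finite dimensional over the base field `k`, which acts through `A`. -/
def IsFD (M : ModuleCat.{u} A) : Prop := Module.Finite k M

/-- `M` is a brick: the endomorphisms of `M` are exactly the scalars, `End M = k`. -/
def IsBrick (M : ModuleCat.{u} A) : Prop :=
  Function.Bijective (fun c : k => c • 𝟙 M)

/-- A brick set (a family of pairwise orthogonal bricks) of finite dimensional modules. -/
structure IsBrickFamily {ι : Type} (E : ι → ModuleCat.{u} A) : Prop where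
  isFD : ∀ s, IsFD k (E s)
  isBrick : ∀ s, IsBrick k (E s)
  orthogonal : ∀ s t, s ≠ t → ∀ f : E s ⟶ E t, f = 0

/-- `g` is right almost split in the category of finite dimensional modules. -/
def IsRightAlmostSplit {F Z : ModuleCat.{u} A} (g : F ⟶ Z) : Prop :=
  ¬ IsSplitEpi g ∧
    ∀ (W : ModuleCat.{u} A) (h : W ⟶ Z), IsFD k W → ¬ IsSplitEpi h → ∃ h' : W ⟶ F, h' ≫ g = h

/-- `f` is left almost split in the category of finite dimensional modules. -/
def IsLeftAlmostSplit {X F : ModuleCat.{u} A} (f : X ⟶ F) : Prop :=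
  ¬ IsSplitMono f ∧
    ∀ (W : ModuleCat.{u} A) (h : X ⟶ W), IsFD k W → ¬ IsSplitMono h → ∃ h' : F ⟶ W, f ≫ h' = h

/-- `0 ⟶ X₁ ⟶ X₂ ⟶ X₃ ⟶ 0` is an almost split (Auslander–Reiten) sequence in the category of
finite dimensional modules. -/
structure IsAlmostSplit (S : ShortComplex (ModuleCat.{u} A)) : Prop where
  shortExact : S.ShortExact
  isFD₁ : IsFD k S.X₁
  isFD₂ : IsFD k S.X₂
  isFD₃ : IsFD k S.X₃
  left : IsLeftAlmostSplit k S.f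
  right : IsRightAlmostSplit k S.g

/-- `τ Z ≅ X` for the Auslander–Reiten translation `τ` of the category of finite dimensional
modules: there is an almost split sequence `0 ⟶ X ⟶ F ⟶ Z ⟶ 0`. -/
def IsTranslate (Z X : ModuleCat.{u} A) : Prop :=
  ∃ S : ShortComplex (ModuleCat.{u} A),
    IsAlmostSplit k S ∧ Nonempty (S.X₁ ≅ X) ∧ Nonempty (S.X₃ ≅ Z)

/-- `(E_1, …, E_r)` is a `τ`-cycle: `τ E_s ≅ E_{s-1}` for all `s ∈ ℤ/r`. -/
def IsTauCycle {r : ℕ} (E : ZMod r → ModuleCat.{u} A) : Prop :=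
  ∀ s, IsTranslate k (E s) (E (s - 1))

end

section

variable {A : Type u} [Ring A] {ι : Type}

/-- The family is self-hereditary: `Ext²_A(E_s, E_t) = 0` for all `s`, `t`. -/
def IsSelfHereditary (E : ι → ModuleCat.{u} A) : Prop :=
  ∀ s t, Subsingleton (Abelian.Ext (E s) (E t) 2)

/-- There is a chain of submodules `M = N 0 ⊋ N 1 ⊋ ⋯ ⊋ N l = 0` all of whose factors
`N m / N (m + 1)` are isomorphic to members of the family `E`. -/
def HasFiltration (E : ι → ModuleCat.{u} A) (M : ModuleCat.{u} A) (l : ℕ) : Prop :=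
  ∃ N : ℕ → Submodule A M, N 0 = ⊤ ∧ N l = ⊥ ∧
    ∀ m < l, N (m + 1) < N m ∧
      ∃ s, Nonempty ((N m ⧸ (N (m + 1)).submoduleOf (N m)) ≃ₗ[A] E s)

/-- `M` belongs to the extension category `𝓔 = EXT_A(E)` of the family `E`
(the zero module belongs to it, by the chain with `l = 0`). -/
def InExtCat (E : ι → ModuleCat.{u} A) (M : ModuleCat.{u} A) : Prop :=
  ∃ l, HasFiltration E M l

/-- `M` is uniserial in `𝓔`: the submodules of `M` that belong to `𝓔` form a chain. -/
def IsUniserial (E : ι → ModuleCat.{u} A) (M : ModuleCat.{u} A) : Prop :=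
  ∀ N N' : Submodule A M, InExtCat E (ModuleCat.of A N) → InExtCat E (ModuleCat.of A N') →
    N ≤ N' ∨ N' ≤ N

/-- `M` is (a copy of) `E_s[j]`: a uniserial object of the extension category `𝓔` that has
`𝓔`-length `j` (the members of `E` are the simple objects of `𝓔`, so a chain as in
`HasFiltration` is a composition series in `𝓔`), and whose simple `𝓔`-subobject is `E_s`. -/
structure IsTubeObject (E : ι → ModuleCat.{u} A) (s : ι) (j : ℕ) (M : ModuleCat.{u} A) :
    Prop where
  length : HasFiltration E M j
  uniserial : IsUniserial E M
  socle : ∃ N : Submodule A M, Nonempty (N ≃ₗ[A] E s)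

end

end StableTube

namespace StableTube

open CategoryTheory Limits Abelian

/-! ### Short exact sequences and their classes in Ext¹ -/

section Extensions

universe w' v' u'

variable {C : Type u'} [Category.{v'} C] [Abelian C]

/-! The objects E_i[j] are handled as towers (`IsTower`): iterated non-split extensions with factors
E_i, …, E_{i+j-1}. Almost split sequences and the brick condition make Ext¹(E_s, E_t) a line for s =
t + 1 and zero otherwise. This passes to a tower M with top E_t and largest proper subtower M': the
map Ext¹(E_s, M) → Ext¹(E_s, E_t) is injective because the class of M generates Ext¹(E_s, M')
(`IsTower.hasExtCyclic`), and surjective because Ext² vanishes. So a non-zero tower has, up to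
isomorphism, exactly one non-split extension by a mouth object, whence existence (`exists_isTower`)
and uniqueness (`IsTower.nonempty_iso`).

A morphism from a tower to a mouth object factors through the top. In a tower of length at most r
the non-zero subtowers have distinct tops, so only one of them can receive a morphism that is
non-zero on tops. Hence Hom is at most a line (`IsTower.exists_smul_hom`), and it is non-zero
exactly when the target has a non-zero subtower with the top of the source and no longer than it
(`IsTower.exists_hom_ne_zero_iff`); `exists_length_iff` is the arithmetic. In lengths 1 to r, towers
are the same as the uniserial objects of the statement (`IsTower.isTubeObject`,
`IsTubeObject.isTower`). -/

lemma shortExact_pushout {S : ShortComplex C} (hS : S.ShortExact) {Y : C} (h : S.X₁ ⟶ Y) :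
    (ShortComplex.mk (pushout.inr S.f h)
      (pushout.desc S.g (0 : Y ⟶ S.X₃) (S.zero.trans comp_zero.symm)) (pushout.inr_desc _ _ _)).ShortExact := by
  have := hS.mono_f
  have := hS.epi_g
  refine { exact := ?_, mono_f := ?_, epi_g := ?_ }
  · apply ShortComplex.exact_of_g_is_cokernel
    refine CokernelCofork.IsColimit.ofπ _ _
      (fun {Z} a ha => hS.exact.desc (pushout.inl S.f h ≫ a) ?_) ?_ ?_
    · rw [pushout.condition_assoc]
      simp only at ha
      rw [ha, comp_zero]
    · intro Z a ha
      simp only at ha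
      ext
      · simp [pushout.inl_desc_assoc]
      · simp [ha, pushout.inr_desc_assoc]
    · intro Z a ha m hm
      simp only at hm
      rw [← cancel_epi S.g]
      simp [← hm, pushout.inl_desc_assoc]
  · dsimp
    infer_instance
  · have : Epi (pushout.inl S.f h ≫ pushout.desc S.g (0 : Y ⟶ S.X₃)
        (S.zero.trans comp_zero.symm)) := by
      rw [pushout.inl_desc]
      exact hS.epi_g
    exact epi_of_epi (pushout.inl S.f h) _

variable [HasExt.{w'} C]

lemma extClass_eq_zero_iff {S : ShortComplex C} (hS : S.ShortExact) :
    hS.extClass = 0 ↔ ∃ s : S.X₃ ⟶ S.X₂, s ≫ S.g = 𝟙 _ := by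
  constructor
  · intro h
    obtain ⟨x, hx⟩ := Ext.covariant_sequence_exact₃ S.X₃ hS (Ext.mk₀ (𝟙 S.X₃)) (zero_add 1)
      (by simp [h])
    obtain ⟨s, rfl⟩ := (Ext.mk₀_bijective _ _).2 x
    rw [Ext.mk₀_comp_mk₀] at hx
    exact ⟨s, (Ext.mk₀_bijective _ _).1 hx⟩
  · rintro ⟨s, hs⟩
    rw [← Ext.mk₀_id_comp hS.extClass, ← hs, ← Ext.mk₀_comp_mk₀_assoc, hS.comp_extClass,
      Ext.comp_zero]

/-- A morphism out of the left term extends if it kills the class of the extension. -/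
lemma exists_extension_of_comp_eq_zero {S : ShortComplex C} (hS : S.ShortExact) {Y : C}
    (h : S.X₁ ⟶ Y) (hh : hS.extClass.comp (Ext.mk₀ h) (add_zero 1) = 0) :
    ∃ h' : S.X₂ ⟶ Y, S.f ≫ h' = h := by
  obtain ⟨x, hx⟩ := Ext.contravariant_sequence_exact₁ hS Y (Ext.mk₀ h) (add_zero 1) hh
  obtain ⟨s, rfl⟩ := (Ext.mk₀_bijective _ _).2 x
  rw [Ext.mk₀_comp_mk₀] at hx
  exact ⟨s, (Ext.mk₀_bijective _ _).1 hx⟩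

lemma exists_shortExact_extClass_eq [EnoughProjectives C] {X Y : C} (b : Ext.{w'} X Y 1) :
    ∃ (M : C) (f : Y ⟶ M) (g : M ⟶ X) (w : f ≫ g = 0)
      (h : (ShortComplex.mk f g w).ShortExact), h.extClass = b := by
  let S := ShortComplex.mk _ _ (kernel.condition (Projective.π X))
  have hS : S.ShortExact :=
    { exact := ShortComplex.exact_of_f_is_kernel _ (kernelIsKernel S.g)
      mono_f := by dsimp [S]; infer_instance
      epi_g := by dsimp [S]; infer_instance }
  -- Ext¹ out of a projective vanishes, so `b` comes from a morphism on the syzygy; pushing out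
  -- along it realizes `b`.
  obtain ⟨x, hx⟩ := Ext.contravariant_sequence_exact₃ hS Y b (Ext.eq_zero_of_projective _)
    (add_zero 1)
  obtain ⟨h, rfl⟩ := (Ext.mk₀_bijective _ _).2 x
  refine ⟨_, _, _, _, shortExact_pushout hS h, ?_⟩
  have := ShortComplex.ShortExact.extClass_naturality hS (shortExact_pushout hS h)
    { τ₁ := h, τ₂ := pushout.inl S.f h, τ₃ := 𝟙 _,
      comm₁₂ := pushout.condition.symm, comm₂₃ := by simp [pushout.inl_desc] }
  rw [hx] at this
  simpa using this.symm

lemma ext_eq_zero_of_isZero {X Y : C} (hY : IsZero Y) {n : ℕ} (x : Ext.{w'} X Y n) : x = 0 := by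
  rw [← Ext.comp_mk₀_id x, hY.eq_zero_of_tgt (𝟙 Y), Ext.mk₀_zero, Ext.comp_zero]

end Extensions

/-! ### Towers over a mouth: Ext groups, existence, uniqueness -/

section Tower

universe v' u'

variable (k : Type w) [Field k] {C : Type u'} [Category.{v'} C] [Abelian C] [Linear k C]

/-- The homological properties of a family of objects that make it the mouth of a tube. -/
structure IsMouth [HasExt.{v'} C] {r : ℕ} (E : ZMod r → C) : Prop where
  eq_of_ne_zero : ∀ {s t} (f : E s ⟶ E t), f ≠ 0 → s = t
  exists_smul : ∀ {s} (f : E s ⟶ E s), ∃ c : k, f = c • 𝟙 _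
  id_ne_zero : ∀ s, 𝟙 (E s) ≠ 0
  ext_two : ∀ {s t} (x : Ext.{v'} (E s) (E t) 2), x = 0
  ext_one_eq_zero : ∀ {s t} (x : Ext.{v'} (E s) (E t) 1), t + 1 ≠ s → x = 0
  exists_ext_one_ne_zero : ∀ t, ∃ x : Ext.{v'} (E (t + 1)) (E t) 1, x ≠ 0
  -- One-dimensionality of Ext¹ in divisibility form, which needs no scalar action on Ext.
  exists_comp : ∀ {s t i} (x : Ext.{v'} (E s) (E i) 1) (b : Ext.{v'} (E t) (E i) 1), b ≠ 0 →
    ∃ v : E s ⟶ E t, x = (Ext.mk₀ v).comp b (zero_add 1)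

variable {k}

/-- `M` is an iterated non-split extension with factors `E i, E (i + 1), …, E (i + j - 1)`,
from the bottom to the top. -/
inductive IsTower {r : ℕ} (E : ZMod r → C) (i : ZMod r) : ℕ → C → Prop
  | zero {M : C} : IsZero M → IsTower E i 0 M
  | succ {j : ℕ} {M' M : C} {t : ZMod r} (f : M' ⟶ M) (g : M ⟶ E t) (w : f ≫ g = 0) :
      IsTower E i j M' → t = i + j → (ShortComplex.mk f g w).ShortExact →
      -- Non-splitness: a non-zero composite would be invertible. Length one is exempt, since the
      -- extension of `E t` by zero does split.
      (j ≠ 0 → ∀ s : E t ⟶ M, s ≫ g = 0) → IsTower E i (j + 1) M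

variable {r : ℕ} {E : ZMod r → C}

lemma IsTower.isZero {i : ZMod r} {M : C} (hM : IsTower E i 0 M) : IsZero M := by
  cases hM; assumption

lemma IsTower.of_iso {i : ZMod r} {j : ℕ} {M N : C} (hM : IsTower E i j M) (e : M ≅ N) :
    IsTower E i j N := by
  cases hM with
  | zero h => exact .zero (h.of_iso e.symm)
  | succ f g w hM' ht hS h =>
    refine .succ (f ≫ e.hom) (e.inv ≫ g) (by simp [w]) hM' ht ?_ fun hj s => ?_
    · exact ShortComplex.shortExact_of_iso
        (ShortComplex.isoMk (S₁ := ShortComplex.mk f g w) (Iso.refl _) e (Iso.refl _) (by simp) (by simp)) hS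
    · simpa using h hj (s ≫ e.inv)

lemma exists_comp_eq_of_comp_eq_zero {M' M N Z : C} {f : M' ⟶ M} {g : M ⟶ Z} {w : f ≫ g = 0}
    (hS : (ShortComplex.mk f g w).ShortExact) (a : N ⟶ M) (ha : a ≫ g = 0) :
    ∃ b : N ⟶ M', b ≫ f = a := by
  have := hS.mono_f
  exact ⟨hS.exact.lift a ha, hS.exact.lift_f a ha⟩

lemma exists_eq_comp_of_comp_eq_zero {M' M N Z : C} {f : M' ⟶ M} {g : M ⟶ Z} {w : f ≫ g = 0}
    (hS : (ShortComplex.mk f g w).ShortExact) (a : M ⟶ N) (ha : f ≫ a = 0) :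
    ∃ b : Z ⟶ N, g ≫ b = a := by
  have := hS.epi_g
  exact ⟨hS.exact.desc a ha, hS.exact.g_desc a ha⟩

variable [HasExt.{v'} C]

lemma IsMouth.isIso_of_ne_zero (hE : IsMouth k E) {s t : ZMod r} (f : E s ⟶ E t) (hf : f ≠ 0) :
    IsIso f := by
  obtain rfl := hE.eq_of_ne_zero f hf
  obtain ⟨c, rfl⟩ := hE.exists_smul f
  have hc : c ≠ 0 := by
    rintro rfl
    simp at hf
  exact ⟨c⁻¹ • 𝟙 _, by simp [smul_smul, hc], by simp [smul_smul, hc]⟩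

lemma IsMouth.extClass_ne_zero (hE : IsMouth k E) {M' M : C} {t : ZMod r} {f : M' ⟶ M}
    {g : M ⟶ E t} {w : f ≫ g = 0} (hS : (ShortComplex.mk f g w).ShortExact)
    (h : ∀ s : E t ⟶ M, s ≫ g = 0) : hS.extClass ≠ 0 := by
  intro h0
  obtain ⟨s, hs⟩ := (extClass_eq_zero_iff hS).1 h0
  exact hE.id_ne_zero t (hs.symm.trans (h s))

lemma IsTower.ext_two (hE : IsMouth k E) {i : ZMod r} {j : ℕ} {M : C} (hM : IsTower E i j M)
    {s : ZMod r} (x : Ext.{v'} (E s) M 2) : x = 0 := by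
  induction hM with
  | zero h => exact ext_eq_zero_of_isZero h x
  | succ f g w _ _ hS _ ih =>
    obtain ⟨y, rfl⟩ := Ext.covariant_sequence_exact₂ _ hS x (hE.ext_two _)
    rw [ih y, Ext.zero_comp]

/-- Every class in `Ext¹(E s, M)` is the pullback of any given non-zero class in `Ext¹(E t, M)`. -/
def HasExtCyclic (E : ZMod r → C) (M : C) : Prop :=
  ∀ ⦃s t : ZMod r⦄ (x : Ext.{v'} (E s) M 1) (b : Ext.{v'} (E t) M 1), b ≠ 0 →
    ∃ v : E s ⟶ E t, x = (Ext.mk₀ v).comp b (zero_add 1)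

/-- Injectivity of Ext¹(E s, M) → Ext¹(E s, E t): its kernel comes from Ext¹(E s, M'), where every
class is a pullback of the class of the sequence, and that class dies in `M`. -/
lemma HasExtCyclic.eq_zero_of_comp_eq_zero {M' M : C} (hM' : HasExtCyclic E M') {t : ZMod r}
    {f : M' ⟶ M} {g : M ⟶ E t} {w : f ≫ g = 0} (hS : (ShortComplex.mk f g w).ShortExact)
    (h0 : hS.extClass ≠ 0 ∨ IsZero M') {s : ZMod r} (x : Ext.{v'} (E s) M 1)
    (hx : x.comp (Ext.mk₀ g) (add_zero 1) = 0) : x = 0 := by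
  obtain ⟨y, rfl⟩ := Ext.covariant_sequence_exact₂ _ hS x hx
  rcases h0 with h0 | h0
  · obtain ⟨v, rfl⟩ := hM' y hS.extClass h0
    rw [Ext.comp_assoc _ _ _ (zero_add 1) (add_zero 1) (by lia), hS.extClass_comp, Ext.comp_zero]
  · rw [ext_eq_zero_of_isZero h0 y, Ext.zero_comp]

lemma IsTower.extClass_ne_zero_or_isZero (hE : IsMouth k E) {i : ZMod r} {j : ℕ} {M' M : C}
    (hM' : IsTower E i j M') {t : ZMod r}
    {f : M' ⟶ M} {g : M ⟶ E t} {w : f ≫ g = 0} (hS : (ShortComplex.mk f g w).ShortExact)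
    (h : j ≠ 0 → ∀ s : E t ⟶ M, s ≫ g = 0) : hS.extClass ≠ 0 ∨ IsZero M' := by
  rcases eq_or_ne j 0 with rfl | hj
  · exact Or.inr hM'.isZero
  · exact Or.inl (hE.extClass_ne_zero hS (h hj))

lemma IsTower.hasExtCyclic (hE : IsMouth k E) {i : ZMod r} {j : ℕ} {M : C}
    (hM : IsTower E i j M) : HasExtCyclic E M := by
  induction hM with
  | zero h => exact fun _ _ x b hb => (hb (ext_eq_zero_of_isZero h b)).elim
  | succ f g w hM' _ hS h ih =>
    have h0 := hM'.extClass_ne_zero_or_isZero hE hS h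
    intro s t x b hb
    obtain ⟨v, hv⟩ := hE.exists_comp (x.comp (Ext.mk₀ g) (add_zero 1))
      (b.comp (Ext.mk₀ g) (add_zero 1)) fun h1 => hb (ih.eq_zero_of_comp_eq_zero hS h0 b h1)
    refine ⟨v, sub_eq_zero.1 (ih.eq_zero_of_comp_eq_zero hS h0 _ ?_)⟩
    rw [sub_eq_add_neg, Ext.add_comp, Ext.neg_comp, hv,
      Ext.comp_assoc _ _ _ (zero_add 1) (add_zero 1) (by lia), add_neg_cancel]

lemma IsTower.ext_one_eq_zero (hE : IsMouth k E) {i : ZMod r} {j : ℕ} {M : C}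
    (hM : IsTower E i j M) {s : ZMod r} (hs : i + j ≠ s) (x : Ext.{v'} (E s) M 1) : x = 0 := by
  cases hM with
  | zero h => exact ext_eq_zero_of_isZero h x
  | succ f g w hM' ht hS h =>
    refine (hM'.hasExtCyclic hE).eq_zero_of_comp_eq_zero hS
      (hM'.extClass_ne_zero_or_isZero hE hS h) x (hE.ext_one_eq_zero _ ?_)
    subst ht
    push_cast at hs
    rwa [add_assoc]

lemma IsTower.exists_ext_one_ne_zero (hE : IsMouth k E) {i : ZMod r} {j : ℕ} {M : C}
    (hM : IsTower E i j M) (hj : j ≠ 0) : ∃ x : Ext.{v'} (E (i + j)) M 1, x ≠ 0 := by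
  cases hM with
  | zero h => exact (hj rfl).elim
  | @succ j M' M t f g w hM' ht hS h =>
    have ht' : t + 1 = i + (j + 1 : ℕ) := by subst ht; push_cast; ring
    rw [← ht']
    obtain ⟨x, hx⟩ := hE.exists_ext_one_ne_zero t
    -- The obstruction to lifting `x` along `g` lies in Ext²(E (t + 1), M') = 0.
    obtain ⟨y, rfl⟩ := Ext.covariant_sequence_exact₃ _ hS x rfl (hM'.ext_two hE _)
    refine ⟨y, ?_⟩
    rintro rfl
    simp at hx

lemma IsTower.exists_succ [EnoughProjectives C] (hE : IsMouth k E) {i : ZMod r} {j : ℕ} {M' : C}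
    (hM' : IsTower E i j M') : ∃ M, IsTower E i (j + 1) M := by
  rcases eq_or_ne j 0 with rfl | hj
  · refine ⟨E i, .succ (0 : M' ⟶ E i) (𝟙 _) (by simp) hM' (by simp) ?_ (by simp)⟩
    exact
      { exact := by
          rw [ShortComplex.exact_iff_mono _ rfl]
          dsimp
          infer_instance
        mono_f := hM'.isZero.mono _
        epi_g := by dsimp; infer_instance }
  · obtain ⟨x, hx⟩ := hM'.exists_ext_one_ne_zero hE hj
    obtain ⟨M, f, g, w, h, rfl⟩ := exists_shortExact_extClass_eq x
    refine ⟨M, .succ f g w hM' rfl h fun _ s => ?_⟩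
    by_contra hs
    have := hE.isIso_of_ne_zero _ hs
    exact hx ((extClass_eq_zero_iff h).2 ⟨inv (s ≫ g) ≫ s, by simp⟩)

lemma exists_isTower [EnoughProjectives C] (hE : IsMouth k E) (i : ZMod r) (j : ℕ) :
    ∃ M, IsTower E i j M := by
  induction j with
  | zero => exact ⟨_, .zero (isZero_zero C)⟩
  | succ j ih =>
    obtain ⟨M, hM⟩ := ih
    exact hM.exists_succ hE

/-- A morphism between the left terms of two extensions of the same mouth object extends to the
middle terms. -/
lemma IsTower.exists_extension (hE : IsMouth k E) {i : ZMod r} {j : ℕ} {N' N M' M : C}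
    (hN' : IsTower E i j N') {t t' : ZMod r}
    {f : M' ⟶ M} {g : M ⟶ E t} {w : f ≫ g = 0} (hS : (ShortComplex.mk f g w).ShortExact)
    {f' : N' ⟶ N} {g' : N ⟶ E t'} {w' : f' ≫ g' = 0} (hS' : (ShortComplex.mk f' g' w').ShortExact)
    (h' : j ≠ 0 → ∀ s : E t' ⟶ N, s ≫ g' = 0) (a : M' ⟶ N') :
    ∃ b : M ⟶ N, f ≫ b = a ≫ f' := by
  apply exists_extension_of_comp_eq_zero hS
  rcases hN'.extClass_ne_zero_or_isZero hE hS' h' with h0 | h0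
  · obtain ⟨v, hv⟩ := hN'.hasExtCyclic hE (hS.extClass.comp (Ext.mk₀ a) (add_zero 1)) _ h0
    rw [← Ext.mk₀_comp_mk₀, ← Ext.comp_assoc _ _ _ (add_zero 1) (zero_add 0) (by lia), hv,
      Ext.comp_assoc _ _ _ (zero_add 1) (add_zero 1) (by lia), hS'.extClass_comp, Ext.comp_zero]
  · rw [h0.eq_of_tgt a 0]
    simp

lemma IsTower.nonempty_iso (hE : IsMouth k E) {i : ZMod r} {j : ℕ} {M N : C}
    (hM : IsTower E i j M) (hN : IsTower E i j N) : Nonempty (M ≅ N) := by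
  induction hM generalizing N with
  | zero h => exact ⟨h.iso hN.isZero⟩
  | @succ j M' M t f g w hM' ht hS h ih =>
    cases hN with
    | @succ _ N' _ t' f' g' w' hN' ht' hS' h' =>
      subst ht'
      subst ht
      rcases eq_or_ne j 0 with rfl | hj
      · have := hS.isIso_g_iff.2 hM'.isZero
        have := hS'.isIso_g_iff.2 hN'.isZero
        exact ⟨asIso g ≪≫ (asIso g').symm⟩
      obtain ⟨e⟩ := ih hN'
      obtain ⟨b, hb⟩ := hN'.exists_extension hE hS hS' h' e.hom
      obtain ⟨c, hc⟩ := exists_eq_comp_of_comp_eq_zero hS (b ≫ g') (by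
        rw [← Category.assoc, hb, Category.assoc, w', comp_zero])
      -- If the map on tops vanished, `b` would land in `N'` and yield a retraction of `f`,
      -- splitting the first sequence.
      have hc0 : c ≠ 0 := by
        rintro rfl
        obtain ⟨b', rfl⟩ := exists_comp_eq_of_comp_eq_zero hS' b (by rw [← hc, comp_zero])
        have : Mono f' := hS'.mono_f
        have h1 : f ≫ b' = e.hom := by
          rw [← cancel_mono f']
          simpa using hb
        obtain ⟨s, hs⟩ := exists_eq_comp_of_comp_eq_zero hS (𝟙 M - b' ≫ e.inv ≫ f) (by
          rw [Preadditive.comp_sub, ← Category.assoc, h1]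
          simp)
        have : Epi g := hS.epi_g
        refine hE.id_ne_zero _ (Eq.trans ?_ (h hj s))
        rw [← cancel_epi g, ← Category.assoc, hs]
        simp [w]
      have := hE.isIso_of_ne_zero c hc0
      let φ : ShortComplex.mk f g w ⟶ ShortComplex.mk f' g' w' :=
        { τ₁ := e.hom, τ₂ := b, τ₃ := c, comm₁₂ := hb.symm, comm₂₃ := hc.symm }
      have : IsIso φ.τ₁ := by dsimp [φ]; infer_instance
      have : IsIso φ.τ₃ := by dsimp [φ]; infer_instance
      have : IsIso φ.τ₂ := ShortComplex.isIso₂_of_shortExact_of_isIso₁₃ φ hS hS'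
      exact ⟨asIso φ.τ₂⟩

end Tower

lemma natCast_zmod_injective {r a b : ℕ} (hab : a ≤ b) (hb : b < a + r)
    (h : (a : ZMod r) = b) : a = b := by
  rw [ZMod.natCast_eq_natCast_iff, Nat.modEq_iff_dvd' hab] at h
  have := Nat.eq_zero_of_dvd_of_lt h (by omega)
  omega

/-! ### Morphisms between towers -/

section Hom

universe v' u'

variable {k : Type w} [Field k] {C : Type u'} [Category.{v'} C] [Abelian C] [Linear k C]
  {r : ℕ} {E : ZMod r → C}

lemma IsTower.exists_mono {i : ZMod r} {j : ℕ} {M : C} (hM : IsTower E i j M) {l : ℕ}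
    (hl : l ≤ j) : ∃ (L : C) (m : L ⟶ M), IsTower E i l L ∧ Mono m := by
  induction hM with
  | @zero M h =>
    obtain rfl : l = 0 := by omega
    exact ⟨M, 𝟙 M, .zero h, inferInstance⟩
  | @succ j M' M t f g w hM' ht hS h ih =>
    rcases hl.eq_or_lt with rfl | hl
    · exact ⟨M, 𝟙 M, .succ f g w hM' ht hS h, inferInstance⟩
    · obtain ⟨L, m, hL, hm⟩ := ih (by omega)
      have : Mono f := hS.mono_f
      exact ⟨L, m ≫ f, hL, inferInstance⟩

variable [HasExt.{v'} C]

/-- Every morphism from a tower to a mouth object vanishes on the largest proper subtower. -/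
lemma IsTower.comp_eq_zero (hE : IsMouth k E) {i : ZMod r} {j : ℕ} {M' M : C}
    (hM' : IsTower E i j M') {t : ZMod r} {f : M' ⟶ M} {g : M ⟶ E t} {w : f ≫ g = 0}
    (hS : (ShortComplex.mk f g w).ShortExact) (h : j ≠ 0 → ∀ s : E t ⟶ M, s ≫ g = 0)
    {s : ZMod r} (u : M ⟶ E s) : f ≫ u = 0 := by
  induction hM' generalizing M t s with
  | zero h0 => exact h0.eq_of_src _ _
  | @succ j M'' M' t' f' g' w' hM'' ht' hS' h' ih =>
    obtain ⟨v, hv⟩ := exists_eq_comp_of_comp_eq_zero hS' (f ≫ u) (ih hS' h' (f ≫ u))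
    by_contra hu
    have hv0 : v ≠ 0 := by
      rintro rfl
      exact hu (by rw [← hv, comp_zero])
    have := hE.isIso_of_ne_zero v hv0
    -- A non-zero restriction to `M'` is `g'` up to an isomorphism, so `g'` extends to `M`. Then the
    -- class of `M` dies under `g'`, hence is zero by injectivity on Ext¹.
    have hg : g' = f ≫ u ≫ inv v := by
      rw [← Category.assoc, ← hv]
      simp
    refine hE.extClass_ne_zero hS (h (by omega)) ((hM''.hasExtCyclic hE).eq_zero_of_comp_eq_zero hS'
      (hM''.extClass_ne_zero_or_isZero hE hS' h') _ ?_)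
    rw [hg, ← Ext.mk₀_comp_mk₀, ← Ext.comp_assoc _ _ _ (add_zero 1) (zero_add 0) (by lia),
      hS.extClass_comp, Ext.zero_comp]

lemma IsTower.hom_mouth_eq_zero (hE : IsMouth k E) {i : ZMod r} {j : ℕ} {M : C}
    (hM : IsTower E i j M) {s : ZMod r} (hs : s + 1 ≠ i + j) (u : M ⟶ E s) : u = 0 := by
  cases hM with
  | zero h => exact h.eq_of_src _ _
  | @succ j M' _ t f g w hM' ht hS h =>
    obtain ⟨v, rfl⟩ := exists_eq_comp_of_comp_eq_zero hS u (hM'.comp_eq_zero hE hS h u)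
    by_contra hv
    have := hE.eq_of_ne_zero v (by rintro rfl; simp at hv)
    apply hs
    subst this ht
    push_cast
    ring

lemma IsTower.exists_smul_hom_mouth (hE : IsMouth k E) {i : ZMod r} {j : ℕ} {M : C}
    (hM : IsTower E i j M) {s : ZMod r} (u₁ u₂ : M ⟶ E s) (hu₂ : u₂ ≠ 0) :
    ∃ c : k, u₁ = c • u₂ := by
  cases hM with
  | zero h => exact (hu₂ (h.eq_of_src _ _)).elim
  | @succ j M' _ t f g w hM' ht hS h =>
    obtain ⟨v₁, rfl⟩ := exists_eq_comp_of_comp_eq_zero hS u₁ (hM'.comp_eq_zero hE hS h u₁)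
    obtain ⟨v₂, rfl⟩ := exists_eq_comp_of_comp_eq_zero hS u₂ (hM'.comp_eq_zero hE hS h u₂)
    have hv₂ : v₂ ≠ 0 := by rintro rfl; simp at hu₂
    have := hE.isIso_of_ne_zero v₂ hv₂
    obtain ⟨c, hc⟩ := hE.exists_smul (v₁ ≫ inv v₂)
    refine ⟨c, ?_⟩
    rw [← Linear.comp_smul]
    congr 1
    rw [← cancel_mono (inv v₂), hc]
    simp

lemma IsTower.hom_eq_zero (hE : IsMouth k E) {i i' : ZMod r} {j j' : ℕ} {M N : C}
    (hM : IsTower E i j M) (hN : IsTower E i' j' N)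
    (hij : ∀ l : ℕ, 1 ≤ l → l ≤ j' → i' + l ≠ i + j) (a : M ⟶ N) : a = 0 := by
  induction hN with
  | zero h => exact h.eq_of_tgt _ _
  | @succ j' N' N t f g w hN' ht hS _ ih =>
    obtain ⟨b, rfl⟩ := exists_comp_eq_of_comp_eq_zero hS a (hM.hom_mouth_eq_zero hE (by
      have := hij (j' + 1) (by omega) (by omega)
      subst ht
      push_cast at this
      rwa [add_assoc]) _)
    rw [ih (fun l hl hl' => hij l hl (by omega)) b, zero_comp]

/-- When the tops of `M` and `N` agree and `N` has length at most `r`, no proper subtower of `N` has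
that top, so nothing non-zero maps into `N'`. -/
lemma IsTower.hom_eq_zero_of_comp_eq_zero (hE : IsMouth k E) {i i' : ZMod r} {j j' : ℕ}
    {M N' N : C} (hM : IsTower E i j M) (hN' : IsTower E i' j' N') {t : ZMod r} {f : N' ⟶ N}
    {g : N ⟶ E t} {w : f ≫ g = 0} (hS : (ShortComplex.mk f g w).ShortExact)
    (hj' : j' + 1 ≤ r) (hij : i' + (j' + 1 : ℕ) = i + j) (a : M ⟶ N) (ha : a ≫ g = 0) :
    a = 0 := by
  obtain ⟨b, rfl⟩ := exists_comp_eq_of_comp_eq_zero hS a ha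
  rw [hM.hom_eq_zero hE hN' (fun l hl hl' h => ?_) b, zero_comp]
  have := natCast_zmod_injective (by omega) (by omega) (add_left_cancel (h.trans hij.symm))
  omega

/-- A non-zero morphism between towers with the same top would be onto, which is impossible if the
target is longer. The induction strips both tops until the source is exhausted. -/
lemma IsTower.hom_eq_zero_of_lt (hE : IsMouth k E) {i i' : ZMod r} {j j' : ℕ} {M N : C}
    (hM : IsTower E i j M) (hN : IsTower E i' j' N) (hj : j < j') (hj' : j' ≤ r)
    (hij : i' + j' = i + j) (a : M ⟶ N) : a = 0 := by
  induction hM generalizing j' N with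
  | zero h => exact h.eq_of_src _ _
  | @succ j M' M t f g w hM' ht hS h ih =>
    cases hN with
    | zero h' => exact h'.eq_of_tgt _ _
    | @succ j' N' _ t' f' g' w' hN' ht' hS' h' =>
      have hij' : i' + j' = i + j := by
        push_cast at hij
        rw [← add_assoc, ← add_assoc] at hij
        exact add_right_cancel hij
      obtain rfl : t = t' := by rw [ht, ht', hij']
      obtain ⟨b, hb⟩ := exists_comp_eq_of_comp_eq_zero hS' (f ≫ a) (by
        rw [Category.assoc]
        exact hM'.comp_eq_zero hE hS h _)
      rw [ih hN' (by omega) (by omega) hij' b, zero_comp] at hb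
      -- Now the morphism factors through the mouth object `E t`, and non-splitness of `N` kills its
      -- component on the top.
      obtain ⟨u, rfl⟩ := exists_eq_comp_of_comp_eq_zero hS a hb.symm
      refine (IsTower.succ f g w hM' ht hS h).hom_eq_zero_of_comp_eq_zero hE hN' hS' hj' hij _ ?_
      rw [Category.assoc, h' (by omega), comp_zero]

/-- Stripping equal tops reduces the target to a single mouth object, where the top projection
works; the morphism is then extended back up through the extensions. -/
lemma IsTower.exists_hom_ne_zero_of_le (hE : IsMouth k E) {i i' : ZMod r} {j l : ℕ} {M N : C}
    (hM : IsTower E i j M) (hN : IsTower E i' l N) (hl : 1 ≤ l) (hj : l ≤ j)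
    (hij : i' + l = i + j) : ∃ a : M ⟶ N, a ≠ 0 := by
  induction hN generalizing j M with
  | zero h => omega
  | @succ l N' N t' f' g' w' hN' ht' hS' h' ih =>
    cases hM with
    | zero => omega
    | @succ j M' M t f g w hM' ht hS h =>
      have hij' : i' + l = i + j := by
        push_cast at hij
        rw [← add_assoc, ← add_assoc] at hij
        exact add_right_cancel hij
      obtain rfl : t = t' := by rw [ht, ht', hij']
      rcases eq_or_ne l 0 with rfl | hl0
      · have : IsIso g' := hS'.isIso_g_iff.2 hN'.isZero
        have : Epi g := hS.epi_g
        refine ⟨g ≫ inv g', fun h0 => hE.id_ne_zero t ?_⟩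
        rw [← cancel_epi g, ← cancel_mono (inv g')]
        simp [h0]
      · obtain ⟨b, hb⟩ := ih hM' (by omega) (by omega) hij'
        obtain ⟨c, hc⟩ := hN'.exists_extension hE hS hS' h' b
        refine ⟨c, ?_⟩
        rintro rfl
        have : Mono f' := hS'.mono_f
        exact hb (by rw [← cancel_mono f', ← hc]; simp)

lemma IsTower.exists_smul_hom (hE : IsMouth k E) {i i' : ZMod r} {j j' : ℕ} {M N : C}
    (hM : IsTower E i j M) (hN : IsTower E i' j' N) (hj' : j' ≤ r) (a₁ a₂ : M ⟶ N) (ha₂ : a₂ ≠ 0) :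
    ∃ c : k, a₁ = c • a₂ := by
  induction hN with
  | zero h => exact (ha₂ (h.eq_of_tgt _ _)).elim
  | @succ j' N' N t f g w hN' ht hS _ ih =>
    by_cases hij : i' + (j' + 1 : ℕ) = i + j
    · obtain ⟨c, hc⟩ := hM.exists_smul_hom_mouth hE (a₁ ≫ g) (a₂ ≫ g) fun h =>
        ha₂ (hM.hom_eq_zero_of_comp_eq_zero hE hN' hS hj' hij a₂ h)
      refine ⟨c, sub_eq_zero.1 (hM.hom_eq_zero_of_comp_eq_zero hE hN' hS hj' hij _ ?_)⟩
      rw [Preadditive.sub_comp, hc, Linear.smul_comp, sub_self]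
    · have h0 (a : M ⟶ N) : a ≫ g = 0 := hM.hom_mouth_eq_zero hE (by
        subst ht
        push_cast at hij
        rwa [add_assoc]) _
      obtain ⟨b₁, rfl⟩ := exists_comp_eq_of_comp_eq_zero hS a₁ (h0 _)
      obtain ⟨b₂, rfl⟩ := exists_comp_eq_of_comp_eq_zero hS a₂ (h0 _)
      obtain ⟨c, rfl⟩ := ih (by omega) b₁ b₂ (by rintro rfl; simp at ha₂)
      exact ⟨c, Linear.smul_comp _ _ _ _ _ _⟩

lemma IsTower.exists_hom_ne_zero_iff (hE : IsMouth k E) {i i' : ZMod r} {j j' : ℕ} {M N : C}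
    (hM : IsTower E i j M) (hN : IsTower E i' j' N) (hj' : j' ≤ r) :
    (∃ a : M ⟶ N, a ≠ 0) ↔ ∃ l : ℕ, 1 ≤ l ∧ l ≤ j ∧ l ≤ j' ∧ i' + l = i + j := by
  constructor
  · rintro ⟨a, ha⟩
    induction hN with
    | zero h => exact (ha (h.eq_of_tgt _ _)).elim
    | @succ j' N' N t f g w hN' ht hS h ih =>
      by_cases hij : i' + (j' + 1 : ℕ) = i + j
      · refine ⟨j' + 1, by omega, ?_, le_rfl, hij⟩
        by_contra hlt
        exact ha (hM.hom_eq_zero_of_lt hE (.succ f g w hN' ht hS h) (by omega) hj' hij a)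
      · obtain ⟨b, rfl⟩ := exists_comp_eq_of_comp_eq_zero hS a (hM.hom_mouth_eq_zero hE (by
          subst ht
          push_cast at hij
          rwa [add_assoc]) _)
        obtain ⟨l, h1, h2, h3, h4⟩ := ih (by omega) b (by rintro rfl; simp at ha)
        exact ⟨l, h1, h2, by omega, h4⟩
  · rintro ⟨l, h1, h2, h3, h4⟩
    obtain ⟨L, m, hL, hm⟩ := hN.exists_mono h3
    obtain ⟨a, ha⟩ := hM.exists_hom_ne_zero_of_le hE hL h1 h2 h4
    refine ⟨a ≫ m, fun h => ha ?_⟩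
    rwa [← cancel_mono m, zero_comp]

end Hom

lemma exists_length_iff {r i j i' j' : ℕ} (hi : 1 ≤ i) (hi' : i ≤ r) (hj' : j ≤ r)
    (h1 : 1 ≤ i') (h2 : i' ≤ r) :
    (∃ l : ℕ, 1 ≤ l ∧ l ≤ j ∧ l ≤ j' ∧ (i' : ZMod r) + l = i + j) ↔
      (((i : ℤ) ≤ i' ∧ (i' : ℤ) ≤ i + j - 1 ∧ (i : ℤ) + j ≤ i' + j') ∨
        ((i' : ℤ) ≤ i + j - 1 - r ∧ (i : ℤ) + j ≤ i' + j' + r)) := by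
  constructor
  · rintro ⟨l, hl1, hl2, hl3, h⟩
    have h' : (((i' + l : ℕ) : ℤ) : ZMod r) = ((i + j : ℕ) : ℤ) := by push_cast; exact h
    obtain ⟨c, hc⟩ := (ZMod.intCast_eq_intCast_iff_dvd_sub _ _ _).1 h'
    push_cast at hc
    -- Here i + j - i' - l = r c. Since l ≤ j, i ≥ 1 and i' ≤ r, the left side exceeds -r; since i,
    -- j ≤ r and i', l ≥ 1, it is below 2r. So c = 0 gives (2a) and c = 1 gives (2b).
    have hc1 : -1 < c := by
      by_contra hlt
      have : (r : ℤ) * c ≤ r * (-1) := by gcongr; omega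
      omega
    have hc2 : c < 2 := by
      by_contra hlt
      have : (r : ℤ) * 2 ≤ r * c := by gcongr; omega
      omega
    obtain rfl | rfl : c = 0 ∨ c = 1 := by omega
    · left; omega
    · right; omega
  · rintro (⟨h5, h6, h7⟩ | ⟨h5, h6⟩)
    · refine ⟨i + j - i', by omega, by omega, by omega, ?_⟩
      rw [← Nat.cast_add, ← Nat.cast_add]
      congr 1
      omega
    · refine ⟨i + j - i' - r, by omega, by omega, by omega, ?_⟩
      have : i + j = i' + (i + j - i' - r) + r := by omega
      have h := congrArg (Nat.cast : ℕ → ZMod r) this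
      push_cast at h
      rw [h, ZMod.natCast_self, add_zero]

/-! ### From almost split sequences to the mouth axioms -/

section Mouth

variable {k : Type w} [Field k] {A : Type u} [Ring A] [Algebra k A]

lemma isFD_of_shortExact {S : ShortComplex (ModuleCat.{u} A)} (hS : S.ShortExact)
    (h₁ : IsFD k S.X₁) (h₃ : IsFD k S.X₃) : IsFD k S.X₂ := by
  unfold IsFD at *
  exact Module.Finite.of_exact (f := S.f.hom.restrictScalars k) (g := S.g.hom.restrictScalars k)
    ((ShortComplex.ShortExact.moduleCat_exact_iff_function_exact S).1 hS.exact)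
    hS.moduleCat_surjective_g

lemma IsTranslate.exists_shortExact {Z X : ModuleCat.{u} A} (h : IsTranslate k Z X) :
    ∃ (F : ModuleCat.{u} A) (f : X ⟶ F) (g : F ⟶ Z) (w : f ≫ g = 0),
      (ShortComplex.mk f g w).ShortExact ∧ IsLeftAlmostSplit k f := by
  obtain ⟨S, hS, ⟨e₁⟩, ⟨e₃⟩⟩ := h
  refine ⟨S.X₂, e₁.inv ≫ S.f, S.g ≫ e₃.hom, by simp, ?_, ?_, ?_⟩
  · exact ShortComplex.shortExact_of_iso
      (ShortComplex.isoMk e₁ (Iso.refl _) e₃ (by simp) (by simp)) hS.shortExact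
  · rintro ⟨⟨ρ, hρ⟩⟩
    refine hS.left.1 ⟨⟨ρ ≫ e₁.inv, ?_⟩⟩
    rw [Category.assoc] at hρ
    rw [← Category.assoc, ← cancel_epi e₁.inv, ← Category.assoc, hρ]
    simp
  · intro W a hW ha
    obtain ⟨b, hb⟩ := hS.left.2 W (e₁.hom ≫ a) hW (by
      rintro ⟨⟨ρ, hρ⟩⟩
      refine ha ⟨⟨ρ ≫ e₁.hom, ?_⟩⟩
      rw [Category.assoc] at hρ
      rw [← cancel_epi e₁.hom, ← Category.assoc, ← Category.assoc, Category.assoc e₁.hom, hρ]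
      simp)
    exact ⟨b, by rw [Category.assoc, hb]; simp⟩

/-- The class of an almost split sequence is a multiple of every non-zero class. -/
lemma IsLeftAlmostSplit.exists_extClass_eq {X F Z : ModuleCat.{u} A} {f : X ⟶ F} {g : F ⟶ Z}
    {w : f ≫ g = 0} (hS : (ShortComplex.mk f g w).ShortExact) (hf : IsLeftAlmostSplit k f)
    (hX : IsFD k X) {Y : ModuleCat.{u} A} (hY : IsFD k Y) (b : Ext.{u} Y X 1) (hb : b ≠ 0) :
    ∃ v : Z ⟶ Y, hS.extClass = (Ext.mk₀ v).comp b (zero_add 1) := by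
  obtain ⟨M, p, q, wpq, hpq, rfl⟩ := exists_shortExact_extClass_eq b
  -- `p` is not split because `b` is non-zero, so it extends over `f`; the induced map on cokernels
  -- is the required `v`.
  obtain ⟨h, hh⟩ := hf.2 M p (isFD_of_shortExact hpq hX hY) (by
    rintro ⟨⟨ρ, hρ⟩⟩
    apply hb
    have := hpq.extClass_comp_assoc (Ext.mk₀ ρ) (h := add_zero 1)
    rwa [Ext.mk₀_comp_mk₀, hρ, Ext.comp_mk₀_id] at this)
  obtain ⟨v, hv⟩ := exists_eq_comp_of_comp_eq_zero hS (h ≫ q) (by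
    rw [← Category.assoc, hh, wpq])
  refine ⟨v, ?_⟩
  have := ShortComplex.ShortExact.extClass_naturality hS hpq
    { τ₁ := 𝟙 _, τ₂ := h, τ₃ := v, comm₁₂ := by simpa using hh.symm, comm₂₃ := by simpa using hv.symm }
  simpa using this

lemma extClass_ne_zero_of_not_isSplitMono {C : Type*} [Category C] [Abelian C] [HasExt.{u} C]
    {S : ShortComplex C} (hS : S.ShortExact) (h : ¬ IsSplitMono S.f) : hS.extClass ≠ 0 := by
  intro h0
  obtain ⟨ρ, hρ⟩ := exists_extension_of_comp_eq_zero hS (𝟙 S.X₁) (by rw [h0, Ext.zero_comp])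
  exact h ⟨⟨ρ, hρ⟩⟩

/-- The almost split class is a pullback of every non-zero class ending in `E i`. The maps involved
are non-zero between orthogonal bricks, hence invertible scalars, so any two non-zero classes are
proportional and start at `E (i + 1)`. -/
lemma isMouth {r : ℕ} {E : ZMod r → ModuleCat.{u} A}
    (hbrick : IsBrickFamily k E) (htau : IsTauCycle k E) (hself : IsSelfHereditary E) :
    IsMouth k E := by
  have h_id (s) : 𝟙 (E s) ≠ 0 := fun h => by
    have := (hbrick.isBrick s).1 (a₁ := 1) (a₂ := 0) (by simp [h])
    exact one_ne_zero this
  have h_eq {s t} (f : E s ⟶ E t) (hf : f ≠ 0) : s = t := by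
    by_contra hst
    exact hf (hbrick.orthogonal s t hst f)
  have h_smul {s} (f : E s ⟶ E s) : ∃ c : k, f = c • 𝟙 _ := by
    obtain ⟨c, hc⟩ := (hbrick.isBrick s).2 f
    exact ⟨c, hc.symm⟩
  have h_ar (i : ZMod r) : ∃ e : Ext.{u} (E (i + 1)) (E i) 1, e ≠ 0 ∧
      ∀ {t} (b : Ext.{u} (E t) (E i) 1), b ≠ 0 →
        ∃ v : E (i + 1) ⟶ E t, e = (Ext.mk₀ v).comp b (zero_add 1) := by
    have h := htau (i + 1)
    rw [add_sub_cancel_right] at h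
    obtain ⟨F, f, g, w, hS, hf⟩ := h.exists_shortExact
    exact ⟨hS.extClass, extClass_ne_zero_of_not_isSplitMono hS hf.1, fun b hb =>
      hf.exists_extClass_eq hS (hbrick.isFD _) (hbrick.isFD _) b hb⟩
  refine ⟨h_eq, h_smul, h_id, fun {s t} x => ?_, fun {s t} x hx => ?_, fun t => ?_,
    fun {s t i} x b hb => ?_⟩
  · have := hself s t
    exact Subsingleton.elim _ _
  · by_contra h0
    obtain ⟨e, he, H⟩ := h_ar t
    obtain ⟨v, rfl⟩ := H x h0
    exact hx (h_eq v (by rintro rfl; simp at he))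
  · obtain ⟨e, he, -⟩ := h_ar t
    exact ⟨e, he⟩
  · rcases eq_or_ne x 0 with rfl | hx
    · exact ⟨0, by simp⟩
    obtain ⟨e, he, H⟩ := h_ar i
    obtain ⟨v, hv⟩ := H x hx
    obtain ⟨v', hv'⟩ := H b hb
    have hv0 : v ≠ 0 := by rintro rfl; simp [hv] at he
    obtain rfl := h_eq v hv0
    obtain ⟨c, rfl⟩ := h_smul v
    have hc : c ≠ 0 := by rintro rfl; simp at hv0
    refine ⟨c⁻¹ • v', ?_⟩
    have hinv : (c⁻¹ • 𝟙 (E (i + 1))) ≫ (c • 𝟙 (E (i + 1))) = 𝟙 _ := by simp [smul_smul, hc]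
    rw [← Ext.mk₀_id_comp x, ← hinv, ← Ext.mk₀_comp_mk₀_assoc, ← hv, hv', Ext.mk₀_comp_mk₀_assoc]
    simp

end Mouth

/-! ### Filtrations by mouth objects -/

section Filtration

variable {A : Type u} [Ring A] {ι : Type} {E : ι → ModuleCat.{u} A}

/-- An injective linear map preserves the factors of a filtration. -/
lemma nonempty_quotient_map_equiv {M M' Z : Type u} [AddCommGroup M] [Module A M]
    [AddCommGroup M'] [Module A M'] [AddCommGroup Z] [Module A Z] {f : M →ₗ[A] M'}
    (hf : Function.Injective f) (N₁ N₂ : Submodule A M) :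
    Nonempty ((N₁ ⧸ N₂.submoduleOf N₁) ≃ₗ[A] Z) ↔
      Nonempty ((N₁.map f ⧸ (N₂.map f).submoduleOf (N₁.map f)) ≃ₗ[A] Z) := by
  have e : (N₁ ⧸ N₂.submoduleOf N₁) ≃ₗ[A] (N₁.map f ⧸ (N₂.map f).submoduleOf (N₁.map f)) := by
    refine Submodule.Quotient.equiv _ _ (Submodule.equivMapOfInjective f hf N₁) ?_
    ext ⟨x, hx⟩
    obtain ⟨y, hy, rfl⟩ := hx
    simp only [Submodule.mem_map, Submodule.submoduleOf, Submodule.mem_comap]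
    constructor
    · rintro ⟨z, hz, h⟩
      exact ⟨z, hz, congrArg Subtype.val h⟩
    · rintro ⟨z, hz, h⟩
      have : z = y := hf h
      subst this
      exact ⟨⟨z, hy⟩, hz, rfl⟩
  exact ⟨fun ⟨a⟩ => ⟨e.symm.trans a⟩, fun ⟨a⟩ => ⟨e.trans a⟩⟩

lemma HasFiltration.of_equiv {M M' : ModuleCat.{u} A} {l : ℕ} (h : HasFiltration E M l)
    (e : M ≃ₗ[A] M') : HasFiltration E M' l := by
  obtain ⟨N, h0, hl, hN⟩ := h
  refine ⟨fun m => (N m).map e.toLinearMap, ?_, ?_, fun m hm => ⟨?_, ?_⟩⟩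
  · simp [h0]
  · simp [hl]
  · exact Submodule.map_strictMono_of_injective e.injective (hN m hm).1
  · obtain ⟨s, hs⟩ := (hN m hm).2
    exact ⟨s, (nonempty_quotient_map_equiv e.injective _ _).1 hs⟩

lemma InExtCat.of_equiv {M M' : ModuleCat.{u} A} (h : InExtCat E M) (e : M ≃ₗ[A] M') :
    InExtCat E M' := by
  obtain ⟨l, hl⟩ := h
  exact ⟨l, hl.of_equiv e⟩

lemma hasFiltration_zero_iff {M : ModuleCat.{u} A} : HasFiltration E M 0 ↔ Subsingleton M := by
  constructor
  · rintro ⟨N, h0, h1, -⟩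
    rw [← Submodule.subsingleton_iff A, ← subsingleton_iff_bot_eq_top, ← h0, h1]
  · intro h
    exact ⟨fun _ => ⊤, rfl, Subsingleton.elim _ _, fun m hm => by omega⟩

lemma HasFiltration.succ {M M' : ModuleCat.{u} A} {l : ℕ} (h : HasFiltration E M' l) {s : ι}
    [Nontrivial (E s)] {f : M' →ₗ[A] M} {g : M →ₗ[A] E s} (hf : Function.Injective f)
    (hfg : Function.Exact f g) (hg : Function.Surjective g) : HasFiltration E M (l + 1) := by
  obtain ⟨N, h0, hl, hN⟩ := h
  -- The chain of `M'` is pushed into `M` and shifted by one, with `⊤` put in front.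
  refine ⟨fun m => Nat.casesOn m ⊤ fun m => (N m).map f, rfl, by simp [hl], fun m hm => ?_⟩
  rcases m with _ | m
  · have hr : (N 0).map f = LinearMap.ker g := by
      rw [h0, Submodule.map_top, LinearMap.exact_iff.1 hfg]
    change (N 0).map f < ⊤ ∧ ∃ s, Nonempty
      ((↥(⊤ : Submodule A M) ⧸ ((N 0).map f).submoduleOf ⊤) ≃ₗ[A] E s)
    rw [hr]
    refine ⟨lt_top_iff_ne_top.2 fun h => ?_, s, ⟨?_⟩⟩
    · obtain ⟨y, hy⟩ := exists_ne (0 : E s)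
      obtain ⟨x, rfl⟩ := hg y
      exact hy (LinearMap.mem_ker.1 (h ▸ Submodule.mem_top))
    · let p := g ∘ₗ (⊤ : Submodule A M).subtype
      have hp : Function.Surjective p := fun y => by
        obtain ⟨x, hx⟩ := hg y
        exact ⟨⟨x, trivial⟩, hx⟩
      exact (Submodule.quotEquivOfEq _ _ rfl).trans (p.quotKerEquivOfSurjective hp)
  · refine ⟨Submodule.map_strictMono_of_injective hf (hN m (by omega)).1, ?_⟩
    obtain ⟨s, hs⟩ := (hN m (by omega)).2
    exact ⟨s, (nonempty_quotient_map_equiv hf _ _).1 hs⟩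

lemma HasFiltration.exists_of_succ {M : ModuleCat.{u} A} {l : ℕ} (h : HasFiltration E M (l + 1)) :
    ∃ (s : ι) (g : M →ₗ[A] E s), Function.Surjective g ∧
      HasFiltration E (ModuleCat.of A (LinearMap.ker g)) l := by
  obtain ⟨N, h0, hl, hN⟩ := h
  obtain ⟨h1, s, ⟨e⟩⟩ := hN 0 (by omega)
  have hle (m : ℕ) (hm : m ≤ l) : N (m + 1) ≤ N 1 := by
    induction m with
    | zero => exact le_rfl
    | succ m ih => exact (hN (m + 1) (by omega)).1.le.trans (ih (by omega))
  let q : M →ₗ[A] N 0 := LinearMap.codRestrict _ LinearMap.id fun x => h0 ▸ Submodule.mem_top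
  let g := e.toLinearMap ∘ₗ ((N 1).submoduleOf (N 0)).mkQ ∘ₗ q
  have hker : LinearMap.ker g = N 1 := by
    ext x
    rw [LinearMap.mem_ker, LinearMap.comp_apply, LinearEquiv.coe_coe, e.map_eq_zero_iff,
      LinearMap.comp_apply, Submodule.mkQ_apply, Submodule.Quotient.mk_eq_zero]
    rfl
  refine ⟨s, g, ?_, ?_⟩
  · refine e.surjective.comp ((Submodule.mkQ_surjective _).comp ?_)
    exact fun x => ⟨x.1, rfl⟩
  · rw [hker]
    have hmap (m : ℕ) (hm : m ≤ l) : ((N (m + 1)).comap (N 1).subtype).map (N 1).subtype =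
        N (m + 1) := by
      rw [Submodule.map_comap_subtype, inf_eq_right]
      exact hle m hm
    refine ⟨fun m => (N (m + 1)).comap (N 1).subtype, by simp, by simp [hl], fun m hm => ⟨?_, ?_⟩⟩
    · have := (hN (m + 1) (by omega)).1
      rw [← hmap m (by omega), ← hmap (m + 1) (by omega)] at this
      exact (Submodule.map_lt_map_iff_of_injective (N 1).injective_subtype).1 this
    · obtain ⟨s, hs⟩ := (hN (m + 1) (by omega)).2
      refine ⟨s, (nonempty_quotient_map_equiv (N 1).injective_subtype _ _).2 ?_⟩
      rw [hmap m (by omega), hmap (m + 1) (by omega)]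
      exact hs

end Filtration

/-! ### Towers and uniserial objects of the extension category -/

section Tube

variable {k : Type w} [Field k] {A : Type u} [Ring A] [Algebra k A] {r : ℕ}
  {E : ZMod r → ModuleCat.{u} A}

lemma IsMouth.nontrivial (hE : IsMouth k E) (s : ZMod r) : Nontrivial (E s) := by
  by_contra h
  rw [not_nontrivial_iff_subsingleton] at h
  exact hE.id_ne_zero s (by ext x; exact Subsingleton.elim _ _)

lemma IsMouth.bijective_of_ne_zero (hE : IsMouth k E) {s t : ZMod r} (f : E s →ₗ[A] E t)
    (hf : f ≠ 0) : s = t ∧ Function.Bijective f := by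
  have hf' : ModuleCat.ofHom f ≠ 0 := fun h => hf (by
    have := congrArg ModuleCat.Hom.hom h
    simpa using this)
  have := hE.isIso_of_ne_zero (ModuleCat.ofHom f) hf'
  exact ⟨hE.eq_of_ne_zero _ hf', (asIso (ModuleCat.ofHom f)).toLinearEquiv.bijective⟩

lemma inExtCat_of_equiv_mouth (hE : IsMouth k E) {M : ModuleCat.{u} A} {s : ZMod r}
    (e : M ≃ₗ[A] E s) : InExtCat E M := by
  have := hE.nontrivial s
  have h0 : HasFiltration E (ModuleCat.of A PUnit.{u + 1}) 0 :=
    hasFiltration_zero_iff.2 inferInstance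
  refine ⟨1, h0.succ (f := 0) (g := e.toLinearMap) (Function.injective_of_subsingleton _)
    (fun x => ?_) e.surjective⟩
  simpa using eq_comm

lemma HasFiltration.nontrivial (hE : IsMouth k E) {M : ModuleCat.{u} A} {l : ℕ}
    (h : HasFiltration E M l) (hl : l ≠ 0) : Nontrivial M := by
  obtain ⟨l, rfl⟩ := Nat.exists_eq_succ_of_ne_zero hl
  obtain ⟨s, g, hg, -⟩ := h.exists_of_succ
  have := hE.nontrivial s
  exact hg.nontrivial

/-- Morphisms from the extension category to the mouth are zero or surjective, and the kernels of
the latter are in the extension category. -/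
lemma HasFiltration.surjective_and_inExtCat_ker (hE : IsMouth k E) {X : ModuleCat.{u} A} {l : ℕ}
    (h : HasFiltration E X l) {t : ZMod r} (g : X →ₗ[A] E t) (hg : g ≠ 0) :
    Function.Surjective g ∧ InExtCat E (ModuleCat.of A (LinearMap.ker g)) := by
  induction l generalizing X with
  | zero =>
    have := hasFiltration_zero_iff.1 h
    exact (hg (Subsingleton.elim _ _)).elim
  | succ l ih =>
    obtain ⟨s, p, hp, hl⟩ := h.exists_of_succ
    have := hE.nontrivial s
    by_cases hgp : LinearMap.ker p ≤ LinearMap.ker g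
    · let v : E s →ₗ[A] E t :=
        (LinearMap.ker p).liftQ g hgp ∘ₗ (p.quotKerEquivOfSurjective hp).symm.toLinearMap
      have hv (x : X) : v (p x) = g x := by
        have : (p.quotKerEquivOfSurjective hp).symm (p x) = (LinearMap.ker p).mkQ x := by
          rw [LinearEquiv.symm_apply_eq]
          rfl
        simp [v, this]
      have hv0 : v ≠ 0 := by
        intro h0
        apply hg
        ext x
        simp [← hv, h0]
      have hbij := (hE.bijective_of_ne_zero v hv0).2
      refine ⟨fun y => ?_, ?_⟩
      · obtain ⟨z, rfl⟩ := hbij.2 y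
        obtain ⟨x, rfl⟩ := hp z
        exact ⟨x, (hv x).symm⟩
      · have : LinearMap.ker g = LinearMap.ker p := by
          ext x
          rw [LinearMap.mem_ker, LinearMap.mem_ker, ← hv, map_eq_zero_iff v hbij.1]
        rw [this]
        exact ⟨l, hl⟩
    -- Otherwise `g` is already non-zero on `ker p`, where induction applies, and `ker g` is an
    -- extension of `E s` by `ker g'`.
    · let g' : LinearMap.ker p →ₗ[A] E t := g ∘ₗ (LinearMap.ker p).subtype
      have hg' : g' ≠ 0 := fun h0 => hgp fun x hx => by
        have := LinearMap.congr_fun h0 ⟨x, hx⟩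
        simpa [g'] using this
      obtain ⟨hsurj, l', hl'⟩ := ih hl g' hg'
      refine ⟨fun y => ?_, l' + 1, ?_⟩
      · obtain ⟨x, hx⟩ := hsurj y
        exact ⟨x.1, hx⟩
      · let a : LinearMap.ker g' →ₗ[A] LinearMap.ker g :=
          LinearMap.codRestrict _ ((LinearMap.ker p).subtype ∘ₗ (LinearMap.ker g').subtype)
            fun x => x.2
        refine hl'.succ (f := a) (g := p ∘ₗ (LinearMap.ker g).subtype) ?_ ?_ ?_
        · intro x y hxy
          exact Subtype.ext (Subtype.ext (congrArg (fun z : LinearMap.ker g => z.1) hxy))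
        · intro x
          constructor
          · intro hx
            exact ⟨⟨⟨x.1, hx⟩, x.2⟩, rfl⟩
          · rintro ⟨y, rfl⟩
            exact y.1.2
        · intro y
          obtain ⟨x, rfl⟩ := hp y
          obtain ⟨z, hz⟩ := hsurj (g x)
          refine ⟨⟨x - z.1, ?_⟩, ?_⟩
          · have : g z.1 = g x := hz
            simp [this]
          · have : p z.1 = 0 := z.2
            simp [this]

/-- A submodule contained in the range of an injective linear map is isomorphic to its preimage. -/
noncomputable def comapEquiv {M M' : Type u} [AddCommGroup M] [Module A M] [AddCommGroup M']
    [Module A M'] {f : M' →ₗ[A] M} (hf : Function.Injective f) (N : Submodule A M)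
    (hN : N ≤ LinearMap.range f) : N.comap f ≃ₗ[A] N :=
  (Submodule.equivMapOfInjective f hf _).trans
    (LinearEquiv.ofEq _ _ (by rw [Submodule.map_comap_eq, inf_eq_right.2 hN]))

lemma ker_eq_range {M' M Z : ModuleCat.{u} A} {f : M' ⟶ M} {g : M ⟶ Z} {w : f ≫ g = 0}
    (hS : (ShortComplex.mk f g w).ShortExact) : LinearMap.ker g.hom = LinearMap.range f.hom :=
  LinearMap.exact_iff.1 ((ShortComplex.ShortExact.moduleCat_exact_iff_function_exact _).1 hS.exact)

lemma IsTower.of_equiv {i : ZMod r} {j : ℕ} {M N : ModuleCat.{u} A} (hM : IsTower E i j M)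
    (e : M ≃ₗ[A] N) : IsTower E i j N :=
  hM.of_iso (LinearEquiv.toModuleIso e)

/-- Such an `N` surjects onto the top with kernel N ∩ M'. If that is a proper subtower of length l <
j < r, then i + l ≠ i + j in ℤ/r, so Ext¹(E t, N ∩ M') = 0 and the resulting section contradicts
non-splitness. Hence `N` contains `M'` and is everything. -/
lemma IsTower.eq_top_or_of_not_le (hE : IsMouth k E) {i : ZMod r} {j : ℕ} {M' M : ModuleCat.{u} A}
    {t : ZMod r} {f : M' ⟶ M} {g : M ⟶ E t} {w : f ≫ g = 0} (ht : t = i + j) (hj : j + 1 ≤ r)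
    (hS : (ShortComplex.mk f g w).ShortExact) (h : j ≠ 0 → ∀ s : E t ⟶ M, s ≫ g = 0)
    (hsub : ∀ N : Submodule A M', InExtCat E (ModuleCat.of A N) →
      N = ⊤ ∨ ∃ l < j, IsTower E i l (ModuleCat.of A N))
    (N : Submodule A M) (hN : InExtCat E (ModuleCat.of A N)) (hle : ¬ N ≤ LinearMap.range f.hom) :
    N = ⊤ := by
  have hf : Function.Injective f.hom := hS.moduleCat_injective_f
  let φ : N →ₗ[A] E t := g.hom ∘ₗ N.subtype
  have hφ : φ ≠ 0 := fun h0 => hle fun x hx => by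
    rw [← ker_eq_range hS]
    exact LinearMap.congr_fun h0 ⟨x, hx⟩
  obtain ⟨l₀, hl₀⟩ := hN
  obtain ⟨hsurj, hker⟩ := hl₀.surjective_and_inExtCat_ker hE φ hφ
  have e : N.comap f.hom ≃ₗ[A] LinearMap.ker φ := by
    refine LinearEquiv.ofBijective (LinearMap.codRestrict _ (LinearMap.codRestrict N
      (f.hom ∘ₗ (N.comap f.hom).subtype) fun x => x.2) fun x => ?_) ⟨?_, ?_⟩
    · exact LinearMap.congr_fun (congrArg ModuleCat.Hom.hom w) x.1
    · intro x y hxy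
      exact Subtype.ext (hf (congrArg (fun z => z.1.1) hxy))
    · rintro ⟨⟨x, hx⟩, hx'⟩
      have : x ∈ LinearMap.range f.hom := by
        rw [← ker_eq_range hS]
        exact hx'
      obtain ⟨y, rfl⟩ := this
      exact ⟨⟨y, hx⟩, rfl⟩
  rcases hsub (N.comap f.hom) (hker.of_equiv e.symm) with htop | ⟨l, hl, hT⟩
  · have hrange : LinearMap.range f.hom ≤ N := by
      rintro _ ⟨y, rfl⟩
      exact Submodule.mem_comap.1 (htop ▸ Submodule.mem_top)
    rw [eq_top_iff]
    intro x _
    obtain ⟨y, hy⟩ := hsurj (g.hom x)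
    have hxy : x - y.1 ∈ LinearMap.ker g.hom := by
      have : g.hom y.1 = g.hom x := hy
      simp [this]
    rw [ker_eq_range hS] at hxy
    simpa using N.add_mem (hrange hxy) y.2
  · exfalso
    have hSE := LinearMap.shortExact_shortComplexKer hsurj
    have hne : i + l ≠ t := by
      rw [ht]
      intro h0
      have := natCast_zmod_injective (by omega) (by omega) (add_left_cancel h0)
      omega
    obtain ⟨s, hs⟩ := (extClass_eq_zero_iff hSE).1
      ((hT.of_equiv (N := ModuleCat.of A (LinearMap.ker φ)) e).ext_one_eq_zero hE hne _)
    exact hE.id_ne_zero t (hs.symm.trans (h (by omega) (s ≫ ModuleCat.ofHom N.subtype)))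

lemma IsTower.eq_top_or_exists (hE : IsMouth k E) {i : ZMod r} {j : ℕ} {M : ModuleCat.{u} A}
    (hM : IsTower E i j M) (hj : j ≤ r) (N : Submodule A M) (hN : InExtCat E (ModuleCat.of A N)) :
    N = ⊤ ∨ ∃ l < j, IsTower E i l (ModuleCat.of A N) := by
  induction hM with
  | zero h =>
    have := ModuleCat.subsingleton_of_isZero h
    exact Or.inl (Subsingleton.elim _ _)
  | @succ j M' M t f g w hM' ht hS h ih =>
    by_cases hle : N ≤ LinearMap.range f.hom
    · have e := comapEquiv (f := f.hom) hS.moduleCat_injective_f N hle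
      refine Or.inr ?_
      rcases ih (by omega) _ (hN.of_equiv e.symm) with htop | ⟨l, hl, hT⟩
      · refine ⟨j, by omega, ?_⟩
        rw [htop] at e
        exact hM'.of_equiv (Submodule.topEquiv.symm.trans e)
      · exact ⟨l, by omega, hT.of_equiv e⟩
    · exact Or.inl (eq_top_or_of_not_le hE ht hj hS h (ih (by omega)) N hN hle)

lemma IsTower.isUniserial (hE : IsMouth k E) {i : ZMod r} {j : ℕ} {M : ModuleCat.{u} A}
    (hM : IsTower E i j M) (hj : j ≤ r) : IsUniserial E M := by
  induction hM with
  | zero h =>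
    have := ModuleCat.subsingleton_of_isZero h
    exact fun N N' _ _ => Or.inl (Subsingleton.elim N N').le
  | @succ j M' M t f g w hM' ht hS h ih =>
    intro N N' hN hN'
    have key := eq_top_or_of_not_le hE ht hj hS h fun N hN =>
      hM'.eq_top_or_exists hE (by omega) N hN
    by_cases hle : N ≤ LinearMap.range f.hom
    · by_cases hle' : N' ≤ LinearMap.range f.hom
      · have hf : Function.Injective f.hom := hS.moduleCat_injective_f
        have hmap {K : Submodule A M} (hK : K ≤ LinearMap.range f.hom) :
            (K.comap f.hom).map f.hom = K := by
          rw [Submodule.map_comap_eq, inf_eq_right.2 hK]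
        rw [← hmap hle, ← hmap hle']
        exact (ih (by omega) _ _ (hN.of_equiv (comapEquiv hf N hle).symm)
          (hN'.of_equiv (comapEquiv hf N' hle').symm)).imp
          (fun h => Submodule.map_mono h) fun h => Submodule.map_mono h
      · rw [key N' hN' hle']
        exact Or.inl le_top
    · rw [key N hN hle]
      exact Or.inr le_top

lemma IsTower.hasFiltration (hE : IsMouth k E) {i : ZMod r} {j : ℕ} {M : ModuleCat.{u} A}
    (hM : IsTower E i j M) : HasFiltration E M j := by
  induction hM with
  | zero h => exact hasFiltration_zero_iff.2 (ModuleCat.subsingleton_of_isZero h)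
  | @succ j M' M t f g w hM' ht hS h ih =>
    have := hE.nontrivial t
    exact ih.succ (f := f.hom) (g := g.hom) hS.moduleCat_injective_f
      ((ShortComplex.ShortExact.moduleCat_exact_iff_function_exact _).1 hS.exact)
      hS.moduleCat_surjective_g

lemma IsTower.exists_socle {i : ZMod r} {j : ℕ} {M : ModuleCat.{u} A}
    (hM : IsTower E i j M) (hj : j ≠ 0) : ∃ N : Submodule A M, Nonempty (N ≃ₗ[A] E i) := by
  induction hM with
  | zero => exact (hj rfl).elim
  | @succ j M' M t f g w hM' ht hS h ih =>
    rcases eq_or_ne j 0 with rfl | hj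
    · have : IsIso g := hS.isIso_g_iff.2 hM'.isZero
      obtain rfl : t = i := by simpa using ht
      exact ⟨⊤, ⟨Submodule.topEquiv.trans (asIso g).toLinearEquiv⟩⟩
    · obtain ⟨N, ⟨e⟩⟩ := ih hj
      exact ⟨N.map f.hom,
        ⟨(Submodule.equivMapOfInjective f.hom hS.moduleCat_injective_f N).symm.trans e⟩⟩

lemma IsTower.isTubeObject (hE : IsMouth k E) {i : ZMod r} {j : ℕ} {M : ModuleCat.{u} A}
    (hM : IsTower E i j M) (hj : 1 ≤ j) (hj' : j ≤ r) : IsTubeObject E i j M :=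
  ⟨hM.hasFiltration hE, hM.isUniserial hE hj', hM.exists_socle (by omega)⟩

lemma IsTubeObject.isTower_succ (hE : IsMouth k E) {i : ZMod r} {j : ℕ} {M : ModuleCat.{u} A}
    (hM : IsTubeObject E i (j + 1) M) : IsTower E i (j + 1) M := by
  induction j generalizing M with
  | zero =>
    obtain ⟨t, p, hp, hl⟩ := hM.length.exists_of_succ
    obtain ⟨N, ⟨e⟩⟩ := hM.socle
    have := hasFiltration_zero_iff.1 hl
    have hzero : IsZero (ModuleCat.of A (LinearMap.ker p)) := ModuleCat.isZero_of_subsingleton _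
    have hpinj : Function.Injective p := by
      rw [← LinearMap.ker_eq_bot]
      exact (Submodule.subsingleton_iff_eq_bot).1 this
    have := hE.nontrivial i
    obtain ⟨y, hy⟩ := exists_ne (0 : E i)
    obtain rfl := (hE.bijective_of_ne_zero (p ∘ₗ N.subtype ∘ₗ e.symm.toLinearMap) fun h0 => hy (by
      have := LinearMap.congr_fun h0 y
      simpa [map_eq_zero_iff p hpinj] using this)).1
    exact .succ _ _ _ (.zero hzero) (by simp) (LinearMap.shortExact_shortComplexKer hp) (by simp)
  | succ j ih =>
    obtain ⟨t, p, hp, hl⟩ := hM.length.exists_of_succ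
    obtain ⟨N, ⟨e⟩⟩ := hM.socle
    have hnt : Nontrivial (LinearMap.ker p) := hl.nontrivial hE (by omega)
    -- A copy of a mouth object mapped isomorphically by `p` would be comparable with `ker p` but
    -- meets it in zero; both are non-zero, so this is impossible.
    have key {s : ZMod r} (a : E s →ₗ[A] M) : p ∘ₗ a = 0 := by
      by_contra h0
      have hbij := (hE.bijective_of_ne_zero _ h0).2
      have ha : Function.Injective a := fun x y hxy => hbij.1 (congrArg p hxy)
      have hra := inExtCat_of_equiv_mouth hE (M := ModuleCat.of A (LinearMap.range a))
        (LinearEquiv.ofInjective a ha).symm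
      rcases hM.uniserial _ _ hra ⟨_, hl⟩ with hle | hle
      · exact h0 (LinearMap.ext fun x => hle ⟨x, rfl⟩)
      · obtain ⟨⟨x, hx⟩, hx0⟩ := exists_ne (0 : LinearMap.ker p)
        obtain ⟨y, rfl⟩ := hle hx
        have : y = 0 := hbij.1 (by simpa using hx)
        subst this
        exact hx0 (by simp)
    have hNp : N ≤ LinearMap.ker p := fun x hx => by
      have := LinearMap.congr_fun (key (N.subtype ∘ₗ e.symm.toLinearMap)) (e ⟨x, hx⟩)
      simpa using this
    have hinj : Function.Injective (LinearMap.ker p).subtype := (LinearMap.ker p).injective_subtype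
    have htube : IsTubeObject E i (j + 1) (ModuleCat.of A (LinearMap.ker p)) := by
      refine ⟨hl, fun K K' hK hK' => ?_, N.comap (LinearMap.ker p).subtype,
        ⟨(comapEquiv hinj N (by simpa using hNp)).trans e⟩⟩
      have := hM.uniserial (K.map (LinearMap.ker p).subtype) (K'.map (LinearMap.ker p).subtype)
        (hK.of_equiv (Submodule.equivMapOfInjective _ hinj K))
        (hK'.of_equiv (Submodule.equivMapOfInjective _ hinj K'))
      rwa [Submodule.map_le_map_iff_of_injective hinj,
        Submodule.map_le_map_iff_of_injective hinj] at this
    have hT := ih htube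
    have hSE := LinearMap.shortExact_shortComplexKer hp
    have hns (s : E t ⟶ M) : s ≫ ModuleCat.ofHom p = 0 := by
      ext x
      exact LinearMap.congr_fun (key s.hom) x
    refine .succ _ _ _ hT ?_ hSE fun _ => hns
    -- The index of the top is forced: any other mouth object has no non-zero extension class with
    -- the tower `ker p`.
    by_contra hne
    exact hE.extClass_ne_zero hSE hns (hT.ext_one_eq_zero hE (Ne.symm hne) _)

lemma IsTubeObject.isTower (hE : IsMouth k E) {i : ZMod r} {j : ℕ} {M : ModuleCat.{u} A}
    (hM : IsTubeObject E i j M) (hj : 1 ≤ j) : IsTower E i j M := by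
  obtain ⟨j, rfl⟩ := Nat.exists_eq_add_of_le' hj
  exact hM.isTower_succ hE

end Tube

end StableTube

/-! ### The theorem -/

theorem theorem2p7 {k : Type w} [Field k] [IsAlgClosed k] {A : Type u} [Ring A] [Algebra k A]
    (r : ℕ) (hr : 1 ≤ r) (E : ZMod r → ModuleCat.{u} A)
    (hbrick : StableTube.IsBrickFamily k E)
    (htau : StableTube.IsTauCycle k E)
    (hself : StableTube.IsSelfHereditary E) :
    -- the objects `E_i[j]` exist and are unique up to isomorphism
    (∀ i j : ℕ, 1 ≤ i → i ≤ r → 1 ≤ j → j ≤ r →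
      (∃ M : ModuleCat.{u} A, StableTube.IsTubeObject E (i : ZMod r) j M) ∧
      ∀ M M' : ModuleCat.{u} A, StableTube.IsTubeObject E (i : ZMod r) j M →
        StableTube.IsTubeObject E (i : ZMod r) j M' → Nonempty (M ≅ M')) ∧
    -- they are bricks
    (∀ i j : ℕ, 1 ≤ i → i ≤ r → 1 ≤ j → j ≤ r →
      ∀ M : ModuleCat.{u} A, StableTube.IsTubeObject E (i : ZMod r) j M →
        StableTube.IsBrick k M) ∧
    -- the homomorphisms between them
    (∀ i j i' j' : ℕ, 1 ≤ i → i ≤ r → 1 ≤ j → j ≤ r → 1 ≤ i' → i' ≤ r → 1 ≤ j' → j' ≤ r →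
      ∀ M M' : ModuleCat.{u} A, StableTube.IsTubeObject E (i : ZMod r) j M →
        StableTube.IsTubeObject E (i' : ZMod r) j' M' →
        ((∃ f : M ⟶ M', f ≠ 0) ↔
          (((i : ℤ) ≤ i' ∧ (i' : ℤ) ≤ i + j - 1 ∧ (i : ℤ) + j ≤ i' + j') ∨
            ((i' : ℤ) ≤ i + j - 1 - r ∧ (i : ℤ) + j ≤ i' + j' + r))) ∧
        ((∃ f : M ⟶ M', f ≠ 0) → Nonempty ((M ⟶ M') ≃ₗ[k] k))) := by
  have hE := StableTube.isMouth hbrick htau hself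
  refine ⟨fun i j _ _ hj hj' => ⟨?_, fun M M' hM hM' => ?_⟩, fun i j _ _ hj hj' M hM => ?_,
    fun i j i' j' hi hir hj hjr hi' hir' hj' hjr' M M' hM hM' => ⟨?_, ?_⟩⟩
  · obtain ⟨M, hM⟩ := StableTube.exists_isTower hE (i : ZMod r) j
    exact ⟨M, hM.isTubeObject hE hj hj'⟩
  · exact (hM.isTower hE hj).nonempty_iso hE (hM'.isTower hE hj)
  · have hT := hM.isTower hE hj
    have hne : 𝟙 M ≠ 0 := by
      have := hM.length.nontrivial hE (by omega)
      obtain ⟨x, hx⟩ := exists_ne (0 : M)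
      exact fun h => hx (LinearMap.congr_fun (congrArg ModuleCat.Hom.hom h) x)
    refine ⟨smul_left_injective k hne, fun f => ?_⟩
    obtain ⟨c, rfl⟩ := hT.exists_smul_hom hE hT hj' f (𝟙 M) hne
    exact ⟨c, rfl⟩
  · rw [(hM.isTower hE hj).exists_hom_ne_zero_iff hE (hM'.isTower hE hj') hjr']
    exact StableTube.exists_length_iff hi hir hjr hi' hir'
  · rintro ⟨f, hf⟩
    refine ⟨(LinearEquiv.ofBijective (LinearMap.toSpanSingleton k (M ⟶ M') f)
      ⟨smul_left_injective k hf, fun g => ?_⟩).symm⟩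
    obtain ⟨c, rfl⟩ := (hM.isTower hE hj).exists_smul_hom hE (hM'.isTower hE hj') hjr' g f hf
    exact ⟨c, rfl⟩
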